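/- **Theorem 3.4.** Let $\varphi:\mathbb R_+\to\mathbb R_+$ be an admissible function, that is, $\varphi$ is nondecreasing, $\varphi(0)=0$, and $\varphi(t_n)\to 0$ implies $t_n\to 0$. Assume that $\varphi$ is strictly convex and differentiable on $\mathbb R_+=[0,\infty)$ (one-sidedly at $0$) with $\varphi'(0)=0$. Let $X$ be a real Banach space with dual $X^*$, let $f:X\to\mathbb R\cup\{+\infty\}$ be proper and lower semicontinuous, and let $\bar x\in\mathrm{dom}(f)=\{x: f(x)<+\infty\}$. Write $B(\cdot,\cdot)$ and $B[\cdot,\cdot]$ for open and closed balls and $f_{u^*}:=f-u^*$ for $u^*\in X^*$. Suppose that $f$ has $\varphi$-SLWP (stable local well-posedness) at $\bar x$: there exist $\delta,r,\tau,\kappa\in(0,\infty)$ such that for every $u^*\in B_{X^*}(0,\delta)$ there is $x_{u^*}\in B_X[\bar x,r]$, with $x_0=\bar x$, satisfying $$\varphi(\kappa\|x-x_{u^*}\|)\le \tau\big(f_{u^*}(x)-f_{u^*}(x_{u^*})\big)\qquad\forall x\in B_X[\bar x,r].$$ For $r>0$ let $\delta_{B_X[\bar x,r]}$ be the indicator function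 ($0$ on $B_X[\bar x,r]$, $+\infty$ elsewhere), and let $\overline{\mathrm{co}}\,g$ be the closed convex envelope of $g$, whose epigraph is the closed convex hull of the epigraph of $g$. Let $\partial$ denote the Clarke–Rockafellar subdifferential: $\partial g(x)=\{x^*\in X^*:\langle x^*,h\rangle\le g^{\uparrow}(x,h)\ \forall h\in X\}$ for $x\in\mathrm{dom}(g)$ and $\partial g(x)=\emptyset$ otherwise, where $$g^{\uparrow}(x,h)=\lim_{\varepsilon\downarrow0}\ \limsup_{u\to x,\ g(u)\to g(x),\ t\downarrow0}\ \inf_{\|w-h\|\le\varepsilon}\frac{g(u+tw)-g(u)}{t}.$$ Then there exists $r>0$ such that $F:=\partial\,\overline{\mathrm{co}}(f+\delta_{B_X[\bar x,r]})$ is strongly metrically $\varphi'$-regular at $(\bar x,0)$. That is, $\varphi'$ is admissible, $0\in F(\bar x)$, and there exist $\rho,\tau,\kappa,\delta\in(0,\infty)$ such that $$\varphi'\big(\tau\, d(x,F^{-1}(y))\big)\le\kappa\, d(y,F(x))\qquad\forall (x,y)\in B_X(\bar x,\rho)\times B_{X^*}(0,\rho),$$ and $F^{-1}(y)\cap B_X(\bar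 x,\delta)$ is a singleton for every $y\in B_{X^*}(0,\rho)$. Here $F^{-1}(y)=\{x: y\in F(x)\}$, the distance to the empty set is $+\infty$, and $\varphi'(+\infty):=+\infty$. -/

import Mathlib

open Set Filter Topology

noncomputable section

namespace TiltStability

/-- An admissible function `φ : ℝ₊ → ℝ₊`: nondecreasing, `φ 0 = 0`, and `φ (t) → 0` forces `t → 0`.
A function on `ℝ₊ = [0, ∞)` is represented by a function on `ℝ` of which only the values on
`Ici 0` are ever used. -/
structure IsAdmissible (φ : ℝ → ℝ) : Prop where
  nonneg : ∀ t, 0 ≤ t → 0 ≤ φ t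
  mono : MonotoneOn φ (Ici 0)
  zero : φ 0 = 0
  forcing : ∀ t : ℕ → ℝ, (∀ n, 0 ≤ t n) →
    Tendsto (fun n => φ (t n)) atTop (𝓝 0) → Tendsto t atTop (𝓝 0)

/-- The derivative `φ'` of a function on `ℝ₊ = [0, ∞)` (one-sided at the end point `0`). -/
def derivNonneg (φ : ℝ → ℝ) : ℝ → ℝ := fun t => derivWithin φ (Ici 0) t

section Functions

variable {X : Type*}

/-- The effective domain of an extended-real-valued function. -/
def effDom (f : X → EReal) : Set X := {x | f x < ⊤}

/-- `f` takes values in `ℝ ∪ {+∞}` and is not identically `+∞`. -/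
def IsProper (f : X → EReal) : Prop := (∀ x, f x ≠ ⊥) ∧ (effDom f).Nonempty

open Classical in
/-- The indicator function `δ_S`: `0` on `S` and `+∞` off `S`. -/
def indicatorFn (S : Set X) : X → EReal := fun x => if x ∈ S then 0 else ⊤

/-- The epigraph of `f`, a subset of `X × ℝ`. -/
def epi (f : X → EReal) : Set (X × ℝ) := {p | f p.1 ≤ (p.2 : EReal)}

end Functions

variable {X : Type*} [NormedAddCommGroup X] [NormedSpace ℝ X]

/-- The tilted function `f_{u*}(x) = f(x) - ⟨u*, x⟩`. -/
def tilt (f : X → EReal) (u : StrongDual ℝ X) : X → EReal := fun x => f x - ((u x : ℝ) : EReal)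

/-- Stable local well-posedness of `f` at `xbar` with respect to `φ`. The minimizers `x_{u*}` are
given by a map `m`; as `f xbar < ⊤` at the points where this notion is used, the inequality at
`x = xbar` forces `f (m u) < ⊤`, so the difference below is never `⊤ - ⊤`. -/
def HasSLWP (φ : ℝ → ℝ) (f : X → EReal) (xbar : X) : Prop :=
  ∃ δ r τ κ : ℝ, 0 < δ ∧ 0 < r ∧ 0 < τ ∧ 0 < κ ∧
    ∃ m : StrongDual ℝ X → X, m 0 = xbar ∧
      ∀ u ∈ Metric.ball (0 : StrongDual ℝ X) δ,
        m u ∈ Metric.closedBall xbar r ∧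
        ∀ x ∈ Metric.closedBall xbar r,
          ((φ (κ * ‖x - m u‖) : ℝ) : EReal) ≤ (τ : EReal) * (tilt f u x - tilt f u (m u))

/-- The closed convex envelope of `g`: the function whose epigraph is the closed convex hull of
the epigraph of `g`. -/
def closedConvexEnvelope (g : X → EReal) : X → EReal := fun x =>
  ⨅ (a : ℝ) (_ : (x, a) ∈ closure (convexHull ℝ (epi g))), (a : EReal)

/-- Rockafellar's generalized directional derivative `f↑(x, h)`. Here `𝓝 x ⊓ comap f (𝓝 (f x))`
is the filter of `u → x` with `f u → f x`; the expression under the limit `ε ↓ 0` is nonincreasing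
in `ε`, so this limit is the supremum over `ε > 0`. -/
def upperDirDeriv (f : X → EReal) (x h : X) : EReal :=
  ⨆ (ε : ℝ) (_ : 0 < ε),
    limsup (fun p : X × ℝ =>
        ⨅ w ∈ Metric.closedBall h ε, (f (p.1 + p.2 • w) - f p.1) / (p.2 : EReal))
      ((𝓝 x ⊓ comap f (𝓝 (f x))) ×ˢ 𝓝[>] (0 : ℝ))

/-- The Clarke-Rockafellar subdifferential (empty off the effective domain). -/
def subdiff (f : X → EReal) (x : X) : Set (StrongDual ℝ X) :=
  {v | x ∈ effDom f ∧ ∀ h : X, ((v h : ℝ) : EReal) ≤ upperDirDeriv f x h}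

section Regularity

variable {E F : Type*} [NormedAddCommGroup E] [NormedAddCommGroup F]

/-- The inverse `T⁻¹ (y) = {x | y ∈ T x}` of a multifunction. -/
def multiInv (T : E → Set F) (y : F) : Set E := {x | y ∈ T x}

/-- The inequality `ψ (τ d(x, T⁻¹ y)) ≤ κ d(y, T x)` for `x`, `y` in the open balls of radius `r`
about `xbar`, `ybar`, where the distance to the empty set is `+∞` and `ψ (+∞) = +∞`: there is
nothing to check if `T x` is empty, and otherwise `T⁻¹ y` must be nonempty. -/
def RegularityInequality (ψ : ℝ → ℝ) (T : E → Set F) (xbar : E) (ybar : F) (r τ κ : ℝ) : Prop :=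
  ∀ x ∈ Metric.ball xbar r, ∀ y ∈ Metric.ball ybar r, (T x).Nonempty →
    (multiInv T y).Nonempty ∧
      ψ (τ * Metric.infDist x (multiInv T y)) ≤ κ * Metric.infDist y (T x)

/-- Strong metric `ψ`-regularity of `T` at `(xbar, ybar)`; the notion includes that `ψ` is
admissible and that `(xbar, ybar)` lies on the graph of `T`. -/
def StronglyMetricallyRegular (ψ : ℝ → ℝ) (T : E → Set F) (xbar : E) (ybar : F) : Prop :=
  IsAdmissible ψ ∧ ybar ∈ T xbar ∧
    ∃ r τ κ δ : ℝ, 0 < r ∧ 0 < τ ∧ 0 < κ ∧ 0 < δ ∧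
      RegularityInequality ψ T xbar ybar r τ κ ∧
      ∀ y ∈ Metric.ball ybar r, ∃ x, multiInv T y ∩ Metric.ball xbar δ = {x}

end Regularity

end TiltStability

end

/-! Let `S` be the ball on which well-posedness holds and `g` the envelope of `f` plus the indicator
of `S`. For each small `u`, well-posedness says that on `S` the function `f` lies above the
continuous convex function `f (m u) + u (x - m u) + τ⁻¹ φ (κ ‖x - m u‖)`, which touches it at `m u`.
Such a minorant passes to `g` globally (`growth_closedConvexEnvelope`), so `g - u` has `m u` as its
only minimizer. As `g` is convex, `mem_subdiff_iff` turns this into `F⁻¹ u = {m u}`. For `v ∈ F x`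
and `d = ‖x - m u‖`, adding the growth at `x` to the subgradient inequality at `m u` gives `φ (κ d)
≤ τ ‖u - v‖ d`. Since `φ' s * s ≤ φ (2 s)`, taking `s = κ d / 2` and cancelling `d` yields the
regularity estimate. -/

open Set Filter Topology

namespace TiltStability

section Scalar

variable {φ : ℝ → ℝ}

/-- An admissible function is positive at positive arguments. -/
theorem IsAdmissible.pos (hφ : IsAdmissible φ) {t : ℝ} (ht : 0 < t) : 0 < φ t := by
  refine lt_of_le_of_ne (hφ.nonneg t ht.le) fun h => ?_
  have := hφ.forcing (fun _ => t) (fun _ => ht.le) (by simp [← h])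
  exact ht.ne' (tendsto_nhds_unique tendsto_const_nhds this)

/-- A nondecreasing convex function of a convex function is convex; this makes the growth minorants
convex. -/
theorem IsAdmissible.convexOn_norm {E : Type*} [NormedAddCommGroup E] [NormedSpace ℝ E]
    (hφ : IsAdmissible φ) (hconv : ConvexOn ℝ (Ici 0) φ) {κ : ℝ} (hκ : 0 ≤ κ) (z : E) :
    ConvexOn ℝ univ fun x => φ (κ * ‖x - z‖) := by
  refine ⟨convex_univ, fun x _ y _ a b ha hb hab => ?_⟩
  have hx : 0 ≤ κ * ‖x - z‖ := by positivity
  have hy : 0 ≤ κ * ‖y - z‖ := by positivity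
  refine le_trans (hφ.mono (by simp only [mem_Ici]; positivity)
    (show (0 : ℝ) ≤ a • (κ * ‖x - z‖) + b • (κ * ‖y - z‖) by
      simp only [smul_eq_mul]; positivity) ?_) (hconv.2 hx hy ha hb hab)
  have h : a • x + b • y - z = a • (x - z) + b • (y - z) := by
    have : z = (a + b) • z := by rw [hab, one_smul]
    rw [smul_sub, smul_sub]
    nth_rewrite 1 [this]
    rw [add_smul]; abel
  have h2 : ‖a • x + b • y - z‖ ≤ a * ‖x - z‖ + b * ‖y - z‖ := by
    rw [h]
    refine (norm_add_le _ _).trans ?_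
    rw [norm_smul, norm_smul, Real.norm_of_nonneg ha, Real.norm_of_nonneg hb]
  calc κ * ‖a • x + b • y - z‖ ≤ κ * (a * ‖x - z‖ + b * ‖y - z‖) := by gcongr
    _ = _ := by simp only [smul_eq_mul]; ring

theorem derivNonneg_strictMono (hconv : StrictConvexOn ℝ (Ici 0) φ)
    (hdiff : DifferentiableOn ℝ φ (Ici 0)) : StrictMonoOn (derivNonneg φ) (Ici 0) := by
  intro x hx y hy hxy
  exact (hconv.derivWithin_lt_slope hx hy hxy (hdiff x hx)).trans
    (hconv.slope_lt_derivWithin hx hy hxy (hdiff y hy))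

/-- The derivative of a strictly convex differentiable function with `φ' (0) = 0` is admissible. -/
theorem isAdmissible_derivNonneg (hconv : StrictConvexOn ℝ (Ici 0) φ)
    (hdiff : DifferentiableOn ℝ φ (Ici 0)) (h0 : derivNonneg φ 0 = 0) :
    IsAdmissible (derivNonneg φ) := by
  have hs := derivNonneg_strictMono hconv hdiff
  have hm := hs.monotoneOn
  refine ⟨fun t ht => ?_, hm, h0, fun t ht hlim => ?_⟩
  · rw [← h0]; exact hm self_mem_Ici ht ht
  · rw [Metric.tendsto_atTop]
    intro ε hε
    have hpos : 0 < derivNonneg φ ε := by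
      rw [← h0]; exact hs self_mem_Ici hε.le hε
    obtain ⟨N, hN⟩ := eventually_atTop.1 (hlim.eventually_lt_const hpos)
    refine ⟨N, fun n hn => ?_⟩
    rw [Real.dist_eq, sub_zero, abs_of_nonneg (ht n)]
    exact (hs.lt_iff_lt (ht n) hε.le).1 (hN n hn)

/-- For convex `φ ≥ 0`, the derivative at `s` is bounded by the difference quotient on
`[s, 2s]`. -/
theorem derivNonneg_mul_le (hφ : IsAdmissible φ) (hconv : ConvexOn ℝ (Ici 0) φ)
    (hdiff : DifferentiableOn ℝ φ (Ici 0)) {s : ℝ} (hs : 0 < s) :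
    derivNonneg φ s * s ≤ φ (2 * s) := by
  have hs' : s ∈ Ici (0 : ℝ) := hs.le
  have h := hconv.derivWithin_le_slope hs' (show (2 * s) ∈ Ici (0 : ℝ) by
    simp only [mem_Ici]; positivity) (by linarith) (hdiff s hs')
  rw [slope_def_field, le_div_iff₀ (by linarith)] at h
  have := hφ.nonneg s hs.le
  unfold derivNonneg
  nlinarith

end Scalar

theorem add_indicatorFn_of_mem {X : Type*} {f : X → EReal} {S : Set X} {x : X} (hx : x ∈ S) :
    (f + indicatorFn S) x = f x := by
  simp [indicatorFn, hx]

theorem add_indicatorFn_of_notMem {X : Type*} {f : X → EReal} {S : Set X} {x : X} (hf : f x ≠ ⊥)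
    (hx : x ∉ S) : (f + indicatorFn S) x = ⊤ := by
  simp [indicatorFn, hx, EReal.add_top_of_ne_bot hf]

variable {X : Type*} [NormedAddCommGroup X] [NormedSpace ℝ X]

/-! ### Clarke-Rockafellar and convex subdifferentials -/

/-- For a function which never takes the value `⊥` and whose strict epigraph is convex, the
Clarke-Rockafellar subdifferential is the subdifferential of convex analysis. -/
theorem mem_subdiff_iff {g : X → EReal} (hbot : ∀ x, g x ≠ ⊥)
    (hconv : Convex ℝ {p : X × ℝ | g p.1 < (p.2 : EReal)}) {x : X} {v : StrongDual ℝ X} :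
    v ∈ subdiff g x ↔ x ∈ effDom g ∧ ∀ y, g x + ((v (y - x) : ℝ) : EReal) ≤ g y := by
  constructor
  · rintro ⟨hx, hv⟩
    refine ⟨hx, fun y => ?_⟩
    obtain ⟨α, hα⟩ : ∃ α : ℝ, (α : EReal) = g x :=
      ⟨(g x).toReal, EReal.coe_toReal (ne_of_lt hx) (hbot x)⟩
    refine EReal.le_of_forall_lt_iff_le.1 fun b hb => ?_
    -- Near `x` one only knows `g u > c`, so the estimate is proved with `c` in place of `g x`, and
    -- `c` then increases to `α`.
    have key : ∀ c : ℝ, c < α → v (y - x) ≤ b - c := by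
      intro c hc
      rw [← EReal.coe_le_coe_iff]
      refine (hv (y - x)).trans (iSup₂_le fun ε hε => ?_)
      refine limsup_le_of_le (by isBoundedDefault) ?_
      have h1 : ∀ᶠ u in 𝓝 x ⊓ comap g (𝓝 (g x)), dist u x < ε ∧ (c : EReal) < g u ∧ g u < ⊤ := by
        refine (Filter.Eventually.filter_mono inf_le_left (Metric.ball_mem_nhds x hε)).and
          (Filter.Eventually.filter_mono inf_le_right ?_)
        refine (tendsto_comap (f := g) (x := 𝓝 (g x))).eventually
          (p := fun z => (c : EReal) < z ∧ z < ⊤) ?_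
        exact (lt_mem_nhds (by rw [← hα]; exact_mod_cast hc)).and (gt_mem_nhds hx)
      have h2 : ∀ᶠ t in 𝓝[>] (0 : ℝ), 0 < t ∧ t < 1 :=
        Ioo_mem_nhdsGT one_pos
      filter_upwards [h1.prod_mk h2]
      rintro ⟨u, t⟩ ⟨⟨hu, hcu, hutop⟩, ht0, ht1⟩
      simp only at hu hcu hutop ht0 ht1 ⊢
      obtain ⟨β, hβ⟩ : ∃ β : ℝ, (β : EReal) = g u :=
        ⟨(g u).toReal, EReal.coe_toReal hutop.ne (hbot u)⟩
      rw [← hβ, EReal.coe_lt_coe_iff] at hcu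
      -- Aim from `u` straight at `y`: this direction is within `ε` of `y - x` because `u` is within
      -- `ε` of `x`.
      refine (iInf₂_le (y - u) ?_).trans ?_
      · rw [mem_closedBall_iff_norm, sub_sub_sub_cancel_left, ← dist_eq_norm, dist_comm]
        exact hu.le
      -- The slack `t (β - c)` puts the point in the strict epigraph and trades `β` for `c` in the
      -- quotient, up to the harmless term `-t² (β - c)`.
      · have hA : ((u, β + t * (β - c)) : X × ℝ) ∈ {p : X × ℝ | g p.1 < (p.2 : EReal)} := by
          simp only [mem_ofPred_eq, ← hβ, EReal.coe_lt_coe_iff]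
          nlinarith
        have hB : ((y, b) : X × ℝ) ∈ {p : X × ℝ | g p.1 < (p.2 : EReal)} := hb
        have hC := hconv hA hB (sub_nonneg.2 ht1.le) ht0.le (sub_add_cancel 1 t)
        simp only [mem_ofPred_eq, Prod.smul_mk, Prod.mk_add_mk, smul_eq_mul] at hC
        have hpt : (1 - t) • u + t • y = u + t • (y - u) := by
          rw [sub_smul, one_smul, smul_sub]; abel
        rw [hpt] at hC
        rw [EReal.div_le_iff_le_mul (by exact_mod_cast ht0) (EReal.coe_ne_top _), ← hβ,
          EReal.sub_le_iff_le_add (Or.inl (EReal.coe_ne_bot _)) (Or.inl (EReal.coe_ne_top _))]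
        refine hC.le.trans ?_
        rw [← EReal.coe_mul, ← EReal.coe_add, EReal.coe_le_coe_iff]
        nlinarith [mul_nonneg (mul_nonneg ht0.le ht0.le) (sub_nonneg.2 hcu.le)]
    rw [← hα, ← EReal.coe_add, EReal.coe_le_coe_iff]
    have : α ≤ b - v (y - x) := le_of_forall_lt fun c hc => by
      obtain ⟨d, hd1, hd2⟩ := exists_between hc
      have := key d hd2
      linarith
    linarith
  · rintro ⟨hx, hv⟩
    refine ⟨hx, fun h => ?_⟩
    obtain ⟨α, hα⟩ : ∃ α : ℝ, (α : EReal) = g x :=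
      ⟨(g x).toReal, EReal.coe_toReal (ne_of_lt hx) (hbot x)⟩
    refine EReal.ge_of_forall_gt_iff_ge.1 fun c hc => ?_
    rw [EReal.coe_lt_coe_iff] at hc
    obtain ⟨ε, hε, hle⟩ : ∃ ε : ℝ, 0 < ε ∧ c ≤ v h - ‖v‖ * ε := by
      refine ⟨(v h - c) / (‖v‖ + 1), by have := norm_nonneg v; apply div_pos <;> linarith, ?_⟩
      have h1 : ‖v‖ * ((v h - c) / (‖v‖ + 1)) ≤ v h - c := by
        rw [mul_div_assoc', div_le_iff₀ (by positivity)]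
        nlinarith [norm_nonneg v]
      linarith
    refine le_trans ?_ (le_iSup₂ (f := fun (ε : ℝ) (_ : 0 < ε) =>
      limsup (fun p : X × ℝ =>
        ⨅ w ∈ Metric.closedBall h ε, (g (p.1 + p.2 • w) - g p.1) / (p.2 : EReal))
      ((𝓝 x ⊓ comap g (𝓝 (g x))) ×ˢ 𝓝[>] (0 : ℝ))) ε hε)
    refine le_limsup_of_frequently_le ?_ (by isBoundedDefault)
    -- For a lower bound on the limsup it suffices to keep the base point fixed at `x`.
    have hpure : pure x ≤ 𝓝 x ⊓ comap g (𝓝 (g x)) :=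
      le_inf (pure_le_nhds x) (by rw [← map_le_iff_le_comap, map_pure]; exact pure_le_nhds _)
    refine Filter.Frequently.filter_mono (Filter.Eventually.frequently ?_)
      (Filter.prod_mono hpure (le_refl (𝓝[>] (0 : ℝ))))
    have h1 : ∀ᶠ u in (pure x : Filter X), u = x := by simp
    filter_upwards [h1.prod_mk (self_mem_nhdsWithin : ∀ᶠ t in 𝓝[>] (0 : ℝ), t ∈ Ioi (0 : ℝ))]
    rintro ⟨u, t⟩ ⟨rfl, ht⟩
    simp only at ht ⊢
    refine le_iInf₂ fun w hw => ?_
    rw [EReal.le_div_iff_mul_le (by exact_mod_cast ht) (EReal.coe_ne_top _), ← hα,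
      EReal.le_sub_iff_add_le (Or.inl (EReal.coe_ne_bot _)) (Or.inl (EReal.coe_ne_top _))]
    refine le_trans ?_ (hv (u + t • w))
    rw [← hα, ← EReal.coe_mul, ← EReal.coe_add, ← EReal.coe_add, EReal.coe_le_coe_iff,
      add_sub_cancel_left, map_smul, smul_eq_mul]
    have h2 : v h - v w ≤ ‖v‖ * ε := by
      rw [← map_sub]
      refine (le_abs_self _).trans ((v.le_opNorm _).trans ?_)
      rw [mem_closedBall_iff_norm'] at hw
      gcongr
    nlinarith

/-! ### Closed convex envelopes and growth -/

theorem closedConvexEnvelope_lt_iff {g : X → EReal} {x : X} {b : EReal} :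
    closedConvexEnvelope g x < b ↔
      ∃ a : ℝ, (x, a) ∈ closure (convexHull ℝ (epi g)) ∧ (a : EReal) < b := by
  simp [closedConvexEnvelope, iInf_lt_iff]

/-- Strict inequalities supply actual points of the closed convex hull below the given levels, so
attainment of the infimum and infinite values need no discussion. -/
theorem convex_closedConvexEnvelope (g : X → EReal) :
    Convex ℝ {p : X × ℝ | closedConvexEnvelope g p.1 < (p.2 : EReal)} := by
  rintro ⟨x, a⟩ hx ⟨y, b⟩ hy s t hs ht hst
  obtain ⟨a', ha, ha'⟩ := closedConvexEnvelope_lt_iff.1 hx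
  obtain ⟨b', hb, hb'⟩ := closedConvexEnvelope_lt_iff.1 hy
  refine closedConvexEnvelope_lt_iff.2
    ⟨s * a' + t * b', (convex_convexHull ℝ (epi g)).closure ha hb hs ht hst, ?_⟩
  simp only [EReal.coe_lt_coe_iff] at ha' hb'
  simp only [Prod.smul_mk, Prod.mk_add_mk, smul_eq_mul, EReal.coe_lt_coe_iff]
  rcases hs.eq_or_lt with rfl | hs
  · have : t = 1 := by linarith
    subst this; linarith
  · nlinarith

theorem closedConvexEnvelope_le (g : X → EReal) (hbot : ∀ x, g x ≠ ⊥) (x : X) :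
    closedConvexEnvelope g x ≤ g x := by
  by_cases htop : g x = ⊤
  · simp [htop]
  · have h := EReal.coe_toReal htop (hbot x)
    rw [← h]
    have hmem : (x, (g x).toReal) ∈ closure (convexHull ℝ (epi g)) :=
      subset_closure (subset_convexHull ℝ (epi g) h.ge)
    exact iInf₂_le_of_le (g x).toReal hmem le_rfl

/-- A continuous convex minorant of `g` is a minorant of its closed convex envelope. -/
theorem le_closedConvexEnvelope {g : X → EReal} {q : X → ℝ} (hq : ConvexOn ℝ univ q)
    (hqc : Continuous q) (hle : ∀ x, (q x : EReal) ≤ g x) (x : X) :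
    (q x : EReal) ≤ closedConvexEnvelope g x := by
  have hsub : closure (convexHull ℝ (epi g)) ⊆ {p : X × ℝ | q p.1 ≤ p.2} := by
    refine closure_minimal (convexHull_min ?_ ?_) (isClosed_le (by fun_prop) (by fun_prop))
    · intro p hp
      exact EReal.coe_le_coe_iff.1 ((hle p.1).trans hp)
    · simpa using hq.convex_epigraph
  exact le_iInf₂ fun a ha => EReal.coe_le_coe_iff.2 (hsub ha)

/-- A growth inequality for the tilted function `f_u` on `S` about a point `z` of `S`, in the form
of a minorant of `f`, passes to the closed convex envelope and becomes global. -/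
theorem growth_closedConvexEnvelope {φ : ℝ → ℝ} (hφ : IsAdmissible φ)
    (hconv : ConvexOn ℝ (Ici 0) φ) (hcont : ContinuousOn φ (Ici 0)) {f : X → EReal}
    (hbot : ∀ x, f x ≠ ⊥) {S : Set X} {κ τ : ℝ} (hκ : 0 < κ) (hτ : 0 < τ) {u : StrongDual ℝ X}
    {z : X} {a : ℝ}
    (h : ∀ x ∈ S, ((a + u (x - z) + τ⁻¹ * φ (κ * ‖x - z‖) : ℝ) : EReal) ≤ f x) (x : X) :
    ((a + u (x - z) + τ⁻¹ * φ (κ * ‖x - z‖) : ℝ) : EReal) ≤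
      closedConvexEnvelope (f + indicatorFn S) x := by
  refine le_closedConvexEnvelope (q := fun x => a + u (x - z) + τ⁻¹ * φ (κ * ‖x - z‖)) ?_ ?_ ?_ x
  · refine ConvexOn.add ⟨convex_univ, fun x _ y _ s t _ _ hst => le_of_eq ?_⟩ ?_
    · simp only [map_sub, map_add, map_smul, smul_eq_mul]
      obtain rfl : t = 1 - s := by linarith
      ring
    · exact (hφ.convexOn_norm hconv hκ.le z).smul (inv_nonneg.2 hτ.le)
  · have : Continuous fun x => φ (κ * ‖x - z‖) :=
      hcont.comp_continuous (by fun_prop) fun x => by simp only [mem_Ici]; positivity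
    exact (by fun_prop : Continuous fun x => a + u (x - z)).add (this.const_mul _)
  · intro x
    by_cases hx : x ∈ S
    · rw [add_indicatorFn_of_mem hx]; exact h x hx
    · rw [add_indicatorFn_of_notMem (hbot x) hx]; exact le_top

/-- The inequality of stable local well-posedness as a minorant of `f`. -/
theorem exists_minorant_of_slwp {φ : ℝ → ℝ} {f : X → EReal}
    (hbot : ∀ x, f x ≠ ⊥) {S : Set X} {xbar : X} (hxbar : xbar ∈ effDom f) (hS : xbar ∈ S)
    {κ τ : ℝ} (hτ : 0 < τ) {u : StrongDual ℝ X} {z : X}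
    (h : ∀ x ∈ S, ((φ (κ * ‖x - z‖) : ℝ) : EReal) ≤ (τ : EReal) * (tilt f u x - tilt f u z)) :
    ∃ a : ℝ, f z = a ∧
      ∀ x ∈ S, ((a + u (x - z) + τ⁻¹ * φ (κ * ‖x - z‖) : ℝ) : EReal) ≤ f x := by
  -- Otherwise the right-hand side at `xbar`, where `f` is finite, would be `⊥`.
  have hz : f z ≠ ⊤ := by
    intro hz
    have h1 := h xbar hS
    have h2 := EReal.coe_toReal (ne_of_lt hxbar) (hbot xbar)
    rw [tilt, tilt, hz, ← h2, ← EReal.coe_sub, EReal.top_sub_coe, EReal.sub_top,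
      EReal.coe_mul_bot_of_pos hτ] at h1
    exact EReal.coe_ne_bot _ (le_bot_iff.1 h1)
  have ha := EReal.coe_toReal hz (hbot z)
  refine ⟨(f z).toReal, ha.symm, fun x hx => ?_⟩
  by_cases hxt : f x = ⊤
  · rw [hxt]; exact le_top
  have hb := EReal.coe_toReal hxt (hbot x)
  have h1 := h x hx
  rw [tilt, tilt, ← ha, ← hb, ← EReal.coe_sub, ← EReal.coe_sub, ← EReal.coe_sub, ← EReal.coe_mul,
    EReal.coe_le_coe_iff] at h1
  rw [← hb, EReal.coe_le_coe_iff, map_sub]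
  have h2 : τ⁻¹ * φ (κ * ‖x - z‖) ≤ (f x).toReal - u x - ((f z).toReal - u z) := by
    rw [inv_mul_le_iff₀ hτ]; exact h1
  linarith

/-- Global growth of `g` about `z` after tilting by `u` bounds the distance to `z` of a point with
subgradient `v` in terms of `‖u - v‖`. -/
theorem growth_le_of_mem_subdiff {φ : ℝ → ℝ} {g : X → EReal}
    (hbot : ∀ x, g x ≠ ⊥) (hconv : Convex ℝ {p : X × ℝ | g p.1 < (p.2 : EReal)})
    {κ τ : ℝ} {u : StrongDual ℝ X} {z : X} {a : ℝ} (hz : g z = a)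
    (h : ∀ x, ((a + u (x - z) + τ⁻¹ * φ (κ * ‖x - z‖) : ℝ) : EReal) ≤ g x) {x : X}
    {v : StrongDual ℝ X} (hv : v ∈ subdiff g x) :
    τ⁻¹ * φ (κ * ‖x - z‖) ≤ ‖u - v‖ * ‖x - z‖ := by
  obtain ⟨hx, hv⟩ := (mem_subdiff_iff hbot hconv).1 hv
  have hb := EReal.coe_toReal (ne_of_lt hx) (hbot x)
  have h1 := hv z
  have h2 := h x
  rw [← hb, EReal.coe_le_coe_iff] at h2
  rw [← hb, hz, ← EReal.coe_add, EReal.coe_le_coe_iff] at h1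
  have h3 := (neg_le_abs _).trans ((u - v).le_opNorm (x - z))
  simp only [sub_apply, map_sub] at h1 h2 h3
  linarith

end TiltStability

/-! ### Strong metric regularity -/

theorem theorem3p4 {X : Type*} [NormedAddCommGroup X] [NormedSpace ℝ X] [CompleteSpace X]
    (φ : ℝ → ℝ) (hφ : TiltStability.IsAdmissible φ)
    (hconv : StrictConvexOn ℝ (Set.Ici 0) φ)
    (hdiff : DifferentiableOn ℝ φ (Set.Ici 0))
    (hφ0 : TiltStability.derivNonneg φ 0 = 0)
    (f : X → EReal) (hproper : TiltStability.IsProper f) (hlsc : LowerSemicontinuous f)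
    (xbar : X) (hxbar : xbar ∈ TiltStability.effDom f)
    (hf : TiltStability.HasSLWP φ f xbar) :
    ∃ r : ℝ, 0 < r ∧
      TiltStability.StronglyMetricallyRegular (TiltStability.derivNonneg φ)
        (TiltStability.subdiff
          (TiltStability.closedConvexEnvelope
            (f + TiltStability.indicatorFn (Metric.closedBall xbar r))))
        xbar (0 : StrongDual ℝ X) := by
  open TiltStability in
  obtain ⟨δ, r, τ, κ, hδ, hr, hτ, hκ, m, hm0, hm⟩ := hf
  have hbot := hproper.1
  refine ⟨r, hr, ?_⟩
  set S := Metric.closedBall xbar r with hSdef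
  set g := closedConvexEnvelope (f + indicatorFn S) with hg
  have hfS : ∀ x, (f + indicatorFn S) x ≠ ⊥ := fun x => by
    by_cases hx : x ∈ S
    · rw [add_indicatorFn_of_mem hx]; exact hbot x
    · rw [add_indicatorFn_of_notMem (hbot x) hx]; exact top_ne_bot
  have hxS : xbar ∈ S := Metric.mem_closedBall_self hr.le
  have hgrow : ∀ u ∈ Metric.ball (0 : StrongDual ℝ X) δ, ∃ a : ℝ, g (m u) = a ∧
      ∀ x, ((a + u (x - m u) + τ⁻¹ * φ (κ * ‖x - m u‖) : ℝ) : EReal) ≤ g x := by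
    intro u hu
    obtain ⟨a, ha, h⟩ := exists_minorant_of_slwp hbot hxbar hxS hτ (hm u hu).2
    have hall := growth_closedConvexEnvelope hφ hconv.convexOn hdiff.continuousOn hbot hκ hτ h
    refine ⟨a, le_antisymm ?_ ?_, hall⟩
    · rw [← ha, ← add_indicatorFn_of_mem (f := f) (hm u hu).1]
      exact closedConvexEnvelope_le _ hfS _
    · simpa [hφ.zero] using hall (m u)
  have hgbot : ∀ x, g x ≠ ⊥ := fun x => by
    obtain ⟨a, -, h⟩ := hgrow 0 (Metric.mem_ball_self hδ)
    exact ((EReal.bot_lt_coe _).trans_le (h x)).ne'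
  have hgconv := convex_closedConvexEnvelope (f + indicatorFn S)
  have hinv : ∀ u ∈ Metric.ball (0 : StrongDual ℝ X) δ, multiInv (subdiff g) u = {m u} := by
    intro u hu
    obtain ⟨a, ha, h⟩ := hgrow u hu
    ext x
    rw [mem_singleton_iff]
    constructor
    · intro hx
      have h1 := growth_le_of_mem_subdiff hgbot hgconv ha h hx
      rw [sub_self, norm_zero, zero_mul] at h1
      by_contra hne
      have h2 : 0 < τ⁻¹ * φ (κ * ‖x - m u‖) :=
        mul_pos (inv_pos.2 hτ) (hφ.pos (mul_pos hκ (norm_pos_iff.2 (sub_ne_zero.2 hne))))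
      exact h2.not_ge h1
    · rintro rfl
      refine (mem_subdiff_iff hgbot hgconv).2 ⟨?_, fun y => ?_⟩
      · change g (m u) < ⊤
        rw [ha]; exact EReal.coe_lt_top a
      · refine le_trans ?_ (h y)
        rw [ha, ← EReal.coe_add, EReal.coe_le_coe_iff]
        have := hφ.nonneg (κ * ‖y - m u‖) (by positivity)
        have := mul_nonneg (inv_nonneg.2 hτ.le) this
        linarith
  -- `κ / 2` and `2 * τ / κ` come from `s = κ d / 2`; `r + 1` makes an open ball containing the
  -- closed ball where the minimizers lie.
  refine ⟨isAdmissible_derivNonneg hconv hdiff hφ0, ?_, δ, κ / 2, 2 * τ / κ, r + 1, hδ,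
    by positivity, by positivity, by positivity, ?_, ?_⟩
  · have h : xbar ∈ multiInv (subdiff g) 0 := by
      rw [hinv 0 (Metric.mem_ball_self hδ), hm0]; rfl
    exact h
  · intro x _ y hy hne
    rw [hinv y hy, Metric.infDist_singleton]
    refine ⟨singleton_nonempty _, ?_⟩
    obtain ⟨a, ha, h⟩ := hgrow y hy
    rw [← div_le_iff₀' (by positivity)]
    refine (Metric.le_infDist hne).2 fun v hv => ?_
    rw [div_le_iff₀' (by positivity)]
    -- The main estimate cancels a factor `‖x - m y‖`, so it must be nonzero.
    rcases eq_or_ne x (m y) with rfl | hxy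
    · rw [dist_self, mul_zero, hφ0]; positivity
    have hd : 0 < ‖x - m y‖ := norm_pos_iff.2 (sub_ne_zero.2 hxy)
    have h1 := growth_le_of_mem_subdiff hgbot hgconv ha h hv
    have h2 := derivNonneg_mul_le hφ hconv.convexOn hdiff (s := κ / 2 * ‖x - m y‖) (by positivity)
    rw [show 2 * (κ / 2 * ‖x - m y‖) = κ * ‖x - m y‖ by ring] at h2
    rw [inv_mul_le_iff₀ hτ] at h1
    rw [dist_eq_norm, dist_eq_norm]
    have h3 : derivNonneg φ (κ / 2 * ‖x - m y‖) * (κ / 2) ≤ τ * ‖y - v‖ :=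
      le_of_mul_le_mul_right (by linarith) hd
    rw [div_mul_eq_mul_div (2 * τ), le_div_iff₀ hκ]
    linarith
  · intro y hy
    refine ⟨m y, ?_⟩
    rw [hinv y hy, inter_eq_left, singleton_subset_iff]
    exact lt_of_le_of_lt (hm y hy).1 (lt_add_one r)
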